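/- Let $\alpha\ge 0$, $\sigma\ge 0$, let $\pi$ be a measure on $(0,\infty)$ with $\int_0^\infty (r\wedge r^2)\,\pi(dr)<\infty$, and let $$\psi(\lambda)=\alpha\lambda+\tfrac12\sigma^2\lambda^2+\int_0^\infty\bigl(e^{-\lambda r}-1+\lambda r\bigr)\pi(dr),\qquad \lambda\ge 0,$$ satisfy $\int^{\infty}\frac{d\lambda}{\psi(\lambda)}<\infty$ (convergence at infinity). Let $((Z_t)_{t\ge 0},(\mathbb P_x)_{x\ge 0})$ be a continuous-state branching process with branching mechanism $\psi$: a $[0,\infty)$-valued time-homogeneous strong Markov process whose paths are right continuous with left limits, with $\mathbb P_x(Z_0=x)=1$ and absorbing state $0$, such that $\mathbb P_x[e^{-\lambda Z_t}]=e^{-xu_t(\lambda)}$ for all $x,t\ge 0$, $\lambda>0$, where $u_t(\lambda)\ge 0$ solves $\partial_t u_t(\lambda)=-\psi(u_t(\lambda))$, $u_0(\lambda)=\lambda$. Let $W$ be the scale function of $\psi$, that is, the continuous, strictly increasing function $W:[0,\infty)\to[0,\infty)$ with $\int_0^\infty e^{-\lambda x}W(x)\,dx=1/\psi(\lambda)$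 for all $\lambda>0$, extended by $W(x)=0$ for $x<0$. For $x>0$ let $G(x,A)=\int_0^\infty \mathbb P_x(Z_t\in A)\,dt$, for Borel sets $A\subset(0,\infty)$, be the potential measure of $Z$ on $(0,\infty)$, and let $\mu(dy)=\frac{W(y)}{y}\,dy$ on $(0,\infty)$. Then, for every $x>0$, the measure $G(x,dy)$ has the density $$g(x,y)=\frac{W(y)-W(y-x)}{y},\qquad y>0,$$ with respect to Lebesgue measure on $(0,\infty)$. Moreover, $\mu$ is a stationary measure for $Z$ on $(0,\infty)$ (it is finite on compact subsets of $(0,\infty)$, and $\int_{(0,\infty)}\mathbb P_x(Z_t\in A)\,\mu(dx)=\mu(A)$ for all $t>0$ and all Borel sets $A\subset(0,\infty)$), and $G(x,dy)$ converges vaguely to $\mu(dy)$ as $x\to\infty$: $G(x,\cdot)$ and $\mu$ are finite on compact subsets of $(0,\infty)$, and $\int f(y)\,G(x,dy)\to\int f\,d\mu$ for every continuous compactly supported $f:(0,\infty)\to[0,\infty)$. -/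

import Mathlib

open MeasureTheory ProbabilityTheory Set Filter Topology
open scoped NNReal ENNReal

noncomputable section

/-- The Lévy–Khintchine data `(α, σ, π)` of a branching mechanism: `α ∈ ℝ`, `σ ≥ 0`, and `π` a
measure on `(0, ∞)` (a measure on `ℝ` that does not charge `(-∞, 0]`) with
`∫ r ∧ r² π(dr) < ∞`; such a measure is finite on compact subsets of `(0, ∞)`. -/
structure BranchingMechanism where
  α : ℝ
  σ : ℝ
  σ_nonneg : 0 ≤ σ
  π : Measure ℝ
  π_nonpos : π (Iic 0) = 0
  π_lt_top : ∫⁻ r, ENNReal.ofReal (min r (r ^ 2)) ∂π < ⊤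

namespace BranchingMechanism

/-- `ψ(q) = α q + σ² q² / 2 + ∫ (e^{-q r} - 1 + q r) π(dr)` for `q ≥ 0`. -/
def psi (b : BranchingMechanism) (q : ℝ) : ℝ :=
  b.α * q + b.σ ^ 2 * q ^ 2 / 2 + ∫ r in Ioi (0 : ℝ), (Real.exp (-q * r) - 1 + q * r) ∂b.π

/-- The integral condition `∫^∞ dq / ψ(q) < ∞` (convergence at infinity). Where `ψ ≤ 0` the
integrand takes the value `∞`, so that `ψ > 0` near infinity is part of the condition. -/
def GreyCondition (b : BranchingMechanism) : Prop :=
  ∃ c : ℝ, 0 < c ∧ ∫⁻ q in Ioi c, (ENNReal.ofReal (b.psi q))⁻¹ < ⊤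

/-- `u t q = u_t(q)` is, for every `q > 0`, a nonnegative solution on `[0, ∞)` of
`∂u_t(q)/∂t = -ψ(u_t(q))`, `u_0(q) = q`. -/
def IsCumulant (b : BranchingMechanism) (u : ℝ → ℝ → ℝ) : Prop :=
  ∀ q : ℝ, 0 < q → u 0 q = q ∧ ∀ t : ℝ, 0 ≤ t →
    0 ≤ u t q ∧ HasDerivWithinAt (fun s => u s q) (-b.psi (u t q)) (Ici 0) t

/-- `W` is the scale function of `ψ`: it vanishes on `(-∞, 0)`, it is continuous, strictly
increasing and nonnegative on `[0, ∞)` (hence positive on `(0, ∞)`), and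
`∫_0^∞ e^{-q x} W(x) dx = 1 / ψ(q)` for `q > 0`. -/
structure IsScaleFunction (b : BranchingMechanism) (W : ℝ → ℝ) : Prop where
  zero_of_neg : ∀ x < 0, W x = 0
  nonneg : ∀ x, 0 ≤ x → 0 ≤ W x
  continuousOn : ContinuousOn W (Ici 0)
  strictMonoOn : StrictMonoOn W (Ici 0)
  integrableOn : ∀ q : ℝ, 0 < q → IntegrableOn (fun x => Real.exp (-q * x) * W x) (Ioi 0)
  laplace : ∀ q : ℝ, 0 < q → ∫ x in Ioi (0 : ℝ), Real.exp (-q * x) * W x = 1 / b.psi q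

end BranchingMechanism

/-- `(Z, P)` is a continuous-state branching process with branching mechanism `ψ`: under `P x` it
starts from `x`, it has right continuous paths with left limits in `[0, ∞)`, it is strong Markov
for its natural filtration, `0` is absorbing, and `P_x[e^{-q Z_t}] = e^{-x u_t(q)}`. -/
structure IsCBProcess (b : BranchingMechanism) {Ω : Type*} [MeasurableSpace Ω]
    (P : Kernel ℝ≥0 Ω) (Z : ℝ≥0 → Ω → ℝ≥0) : Prop where
  isMarkovKernel : IsMarkovKernel P
  measurable : ∀ t, Measurable (Z t)
  right_continuous : ∀ ω t, ContinuousWithinAt (fun s => Z s ω) (Ici t) t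
  left_limits : ∀ ω t, ∃ l, Tendsto (fun s => Z s ω) (𝓝[<] t) (𝓝 l)
  initial : ∀ x, ∀ᵐ ω ∂(P x), Z 0 ω = x
  absorbing : ∀ᵐ ω ∂(P 0), ∀ t, Z t ω = 0
  strong_markov : ∀ (τ : Ω → WithTop ℝ≥0)
    (hτ : IsStoppingTime (Filtration.natural Z fun t => (measurable t).stronglyMeasurable) τ)
    (x : ℝ≥0) (A : Set Ω), MeasurableSet[hτ.measurableSpace] A →
    ∀ (s : ℝ≥0) (B : Set ℝ≥0), MeasurableSet B →
      P x {ω | ω ∈ A ∧ τ ω ≠ ⊤ ∧ Z ((τ ω).untopD 0 + s) ω ∈ B} =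
        ∫⁻ ω in {ω | ω ∈ A ∧ τ ω ≠ ⊤}, P (Z ((τ ω).untopD 0) ω) {ω' | Z s ω' ∈ B} ∂(P x)
  log_laplace : ∃ u, b.IsCumulant u ∧ ∀ (x t : ℝ≥0) (q : ℝ), 0 < q →
    ∫ ω, Real.exp (-q * (Z t ω : ℝ)) ∂(P x) = Real.exp (-(x : ℝ) * u t q)

/-- The potential measure `G(x, dy) = ∫_0^∞ P_x(Z_t ∈ dy) dt` on `(0, ∞)`, as a measure on `ℝ`
which does not charge `(-∞, 0]`. See `potentialMeasure_apply`. -/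
def potentialMeasure {Ω : Type*} [MeasurableSpace Ω] (P : Kernel ℝ≥0 Ω) (Z : ℝ≥0 → Ω → ℝ≥0)
    (x : ℝ≥0) : Measure ℝ :=
  (Measure.bind (volume.restrict (Ioi (0 : ℝ)))
    (fun t => (P x).map (fun ω => (Z t.toNNReal ω : ℝ)))).restrict (Ioi 0)

/-- Right continuous measurable processes are jointly measurable. -/
theorem IsCBProcess.measurable_uncurry {b : BranchingMechanism} {Ω : Type*} [MeasurableSpace Ω]
    {P : Kernel ℝ≥0 Ω} {Z : ℝ≥0 → Ω → ℝ≥0} (h : IsCBProcess b P Z) :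
    Measurable (fun p : ℝ≥0 × Ω => Z p.1 p.2) := by
  let r : ℕ → ℝ≥0 → ℝ≥0 := fun n t => ((⌊((n : ℝ≥0) + 1) * t⌋₊ : ℝ≥0) + 1) / ((n : ℝ≥0) + 1)
  have hr1 : ∀ n t, t ≤ r n t := by
    intro n t
    have hn : (0 : ℝ≥0) < (n : ℝ≥0) + 1 := by positivity
    rw [le_div_iff₀ hn, mul_comm]
    exact (Nat.lt_floor_add_one _).le
  have hr2 : ∀ n t, r n t ≤ t + 1 / ((n : ℝ≥0) + 1) := by
    intro n t
    have hn : (0 : ℝ≥0) < (n : ℝ≥0) + 1 := by positivity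
    have hf : (⌊((n : ℝ≥0) + 1) * t⌋₊ : ℝ≥0) ≤ ((n : ℝ≥0) + 1) * t := Nat.floor_le (by positivity)
    have he : (t + 1 / ((n : ℝ≥0) + 1)) * ((n : ℝ≥0) + 1) = ((n : ℝ≥0) + 1) * t + 1 := by
      field_simp
    rw [div_le_iff₀ hn, he]
    gcongr
  have hlim : ∀ t, Tendsto (fun n => r n t) atTop (𝓝[Ici t] t) := by
    intro t
    refine tendsto_nhdsWithin_iff.2 ⟨?_, Eventually.of_forall fun n => hr1 n t⟩
    refine tendsto_of_tendsto_of_tendsto_of_le_of_le tendsto_const_nhds ?_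
      (fun n => hr1 n t) (fun n => hr2 n t)
    have := (tendsto_one_div_add_atTop_nhds_zero_nat (𝕜 := ℝ≥0)).const_add t
    simpa using this
  have hmeas : ∀ n, Measurable (fun p : ℝ≥0 × Ω => Z (r n p.1) p.2) := by
    intro n
    let d : ℕ → ℝ≥0 := fun k => ((k : ℝ≥0) + 1) / ((n : ℝ≥0) + 1)
    have hd : ∀ t, r n t = d ⌊((n : ℝ≥0) + 1) * t⌋₊ := fun t => rfl
    simp_rw [hd]
    clear_value d
    have h1 : Measurable (fun p : ℕ × Ω => Z (d p.1) p.2) :=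
      measurable_from_prod_countable_right fun k => h.measurable (d k)
    have h2 : Measurable (fun p : ℝ≥0 × Ω => (⌊((n : ℝ≥0) + 1) * p.1⌋₊, p.2)) :=
      (Nat.measurable_floor.comp (measurable_fst.const_mul _)).prodMk measurable_snd
    exact h1.comp h2
  clear_value r
  refine measurable_of_tendsto_metrizable hmeas ?_
  rw [tendsto_pi_nhds]
  intro p
  exact (h.right_continuous p.2 p.1).tendsto.comp (hlim p.1)

/-- `G(x, A) = ∫_0^∞ P_x(Z_t ∈ A) dt` for Borel sets `A ⊆ (0, ∞)`. -/
theorem potentialMeasure_apply {b : BranchingMechanism} {Ω : Type*} [MeasurableSpace Ω]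
    {P : Kernel ℝ≥0 Ω} {Z : ℝ≥0 → Ω → ℝ≥0} (h : IsCBProcess b P Z) (x : ℝ≥0) {A : Set ℝ}
    (hA : MeasurableSet A) (hA0 : A ⊆ Ioi 0) :
    potentialMeasure P Z x A = ∫⁻ t in Ioi (0 : ℝ), P x {ω | (Z t.toNNReal ω : ℝ) ∈ A} := by
  have := h.isMarkovKernel
  have hm : Measurable (fun p : ℝ × Ω => (Z p.1.toNNReal p.2 : ℝ)) :=
    (h.measurable_uncurry.comp
      ((measurable_real_toNNReal.comp measurable_fst).prodMk measurable_snd)).coe_nnreal_real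
  have hm1 : ∀ t : ℝ, Measurable (fun ω => (Z t.toNNReal ω : ℝ)) :=
    fun t => (h.measurable _).coe_nnreal_real
  have hmap : Measurable (fun t : ℝ => (P x).map (fun ω => (Z t.toNNReal ω : ℝ))) := by
    refine Measure.measurable_of_measurable_coe _ fun s hs => ?_
    simp_rw [fun t => Measure.map_apply (μ := P x) (hm1 t) hs]
    exact measurable_measure_prodMk_left (ν := P x) (hm hs)
  rw [potentialMeasure, Measure.restrict_apply hA, inter_eq_self_of_subset_left hA0,
    Measure.bind_apply hA hmap.aemeasurable]
  refine lintegral_congr fun t => ?_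
  rw [Measure.map_apply (hm1 t) hA]
  rfl

/-- `ν`, viewed as a measure on `(0, ∞)`, is finite on compact subsets of `(0, ∞)`. -/
def IsLocallyFiniteOnPos (ν : Measure ℝ) : Prop :=
  ∀ K : Set ℝ, IsCompact K → K ⊆ Ioi 0 → ν K < ⊤

/-- `ν` is a stationary measure on `(0, ∞)`: a Radon measure on `(0, ∞)` such that
`∫ P_x(Z_t ∈ A) ν(dx) = ν(A)` for all `t > 0` and Borel `A ⊆ (0, ∞)`. -/
def IsStationaryMeasure {Ω : Type*} [MeasurableSpace Ω] (P : Kernel ℝ≥0 Ω)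
    (Z : ℝ≥0 → Ω → ℝ≥0) (ν : Measure ℝ) : Prop :=
  ν (Iic 0) = 0 ∧ IsLocallyFiniteOnPos ν ∧
    ∀ t : ℝ≥0, 0 < t → ∀ A : Set ℝ, MeasurableSet A → A ⊆ Ioi 0 →
      ∫⁻ x in Ioi (0 : ℝ), P x.toNNReal {ω | (Z t ω : ℝ) ∈ A} ∂ν = ν A

/-- The measure `μ(dx) = (W(x) / x) dx` on `(0, ∞)`. -/
def scaleMeasure (W : ℝ → ℝ) : Measure ℝ :=
  (volume.restrict (Ioi (0 : ℝ))).withDensity (fun x => ENNReal.ofReal (W x / x))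

/-- Vague convergence on `(0, ∞)` of locally finite measures `ν i` to a locally finite measure
`ν'`. A continuous compactly supported function on `(0, ∞)` is identified with its extension by
zero to `ℝ`. -/
def TendstoVaguely {ι : Type*} (ν : ι → Measure ℝ) (l : Filter ι) (ν' : Measure ℝ) : Prop :=
  (∀ᶠ i in l, IsLocallyFiniteOnPos (ν i)) ∧ IsLocallyFiniteOnPos ν' ∧
    ∀ f : ℝ → ℝ, Continuous f → HasCompactSupport f → tsupport f ⊆ Ioi 0 → (∀ y, 0 ≤ f y) →
      Tendsto (fun i => ∫ y in Ioi (0 : ℝ), f y ∂(ν i)) l (𝓝 (∫ y in Ioi (0 : ℝ), f y ∂ν'))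

end

/-! Everything is tested on `e^{-py} - e^{-qy}` with `0 < p < q`. These functions vanish at `0`, so
they do not see the mass absorbed there, which would make the potential of `e^{-py}` alone diverge.
They are positive on `(0, ∞)` and determine a measure there once their integrals are finite.

The time integral of `P_x[e^{-p Z_t} - e^{-q Z_t}]` telescopes: if `F' = φ/ψ`, then `F(u_t)` has
derivative `-φ(u_t)`. With `φ(s) = 1 - e^{-xs}` the integral equals `∫_p^q (1 - e^{-xs})/ψ(s) ds`.
On the other side, `(e^{-py} - e^{-qy})/y = ∫_p^q e^{-sy} ds`, so a density `w(y)/y` integrates the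
test function to `∫_p^q` of the Laplace transform of `w`. For `w(y) = W(y) - W(y-x)` this transform
is the same `(1 - e^{-xs})/ψ(s)`, which gives the density.

For `μ` the value is `∫_p^q ds/ψ(s)`. The law at time `t` replaces `p, q` by `u_t(p), u_t(q)`, and
the flow preserves `ds/ψ(s)`, hence stationarity. The vague limit is immediate from the density,
since `W(y-x) = 0` once `x > y`.

Apart from `ψ(0) = 0`, what is needed of `ψ` (positivity, a linear bound, continuity of `1/ψ`) is
read off the Laplace transform of `W`. -/

/-! ### Uniqueness from Laplace-type integrals -/

/-- Finite measures on `(0, ∞)` are determined by the moments of `e^{-y}`. -/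
theorem measure_eq_of_forall_lintegral_exp_neg_nat_mul {κ₁ κ₂ : Measure ℝ}
    [IsFiniteMeasure κ₁] [IsFiniteMeasure κ₂] (h1 : κ₁ (Iic 0) = 0) (h2 : κ₂ (Iic 0) = 0)
    (h : ∀ n : ℕ, ∫⁻ y, ENNReal.ofReal (Real.exp (-(n : ℝ) * y)) ∂κ₁ =
      ∫⁻ y, ENNReal.ofReal (Real.exp (-(n : ℝ) * y)) ∂κ₂) : κ₁ = κ₂ := by
  have hX : Measurable (fun y : ℝ => Real.exp (-y)) := by fun_prop
  -- Expand `exp(z e^{-y})` in powers of `z`: the coefficients are the given moments, and `e^{-y} ≤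
  -- 1` almost everywhere justifies integrating term by term.
  have key : ∀ (κ : Measure ℝ) [IsFiniteMeasure κ], κ (Iic 0) = 0 → ∀ z : ℂ,
      HasSum (fun n : ℕ => z ^ n / (n.factorial : ℂ) *
        ((∫⁻ y, ENNReal.ofReal (Real.exp (-(n : ℝ) * y)) ∂κ).toReal : ℂ))
        (complexMGF (fun y : ℝ => Real.exp (-y)) κ z) := by
    intro κ _ hκ z
    have hpos : ∀ᵐ y ∂κ, 0 < y := by
      rw [ae_iff]
      simpa [Iic] using hκ
    have hle : ∀ n : ℕ, ∀ᵐ y ∂κ, ‖z ^ n / (n.factorial : ℂ) *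
        (Real.exp (-(n : ℝ) * y) : ℂ)‖ ≤ ‖z‖ ^ n / (n.factorial : ℝ) := by
      intro n
      filter_upwards [hpos] with y hy
      rw [norm_mul, norm_div, norm_pow, Complex.norm_natCast, Complex.norm_real,
        Real.norm_of_nonneg (Real.exp_pos _).le]
      refine mul_le_of_le_one_right (by positivity) (Real.exp_le_one_iff.2 ?_)
      have : 0 ≤ (n : ℝ) * y := by positivity
      linarith
    have hint : ∀ n : ℕ, Integrable (fun y : ℝ => z ^ n / (n.factorial : ℂ) *
        (Real.exp (-(n : ℝ) * y) : ℂ)) κ := by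
      intro n
      refine Integrable.of_bound (by fun_prop) _ (hle n)
    have hsum := hasSum_integral_of_summable_integral_norm hint (by
      refine Summable.of_nonneg_of_le (fun n => integral_nonneg fun _ => norm_nonneg _)
        (fun n => ?_) ((Real.summable_pow_div_factorial ‖z‖).mul_right (κ.real univ))
      calc ∫ y, ‖z ^ n / (n.factorial : ℂ) * (Real.exp (-(n : ℝ) * y) : ℂ)‖ ∂κ
          ≤ ∫ _, ‖z‖ ^ n / (n.factorial : ℝ) ∂κ :=
            integral_mono_ae (hint n).norm (integrable_const _) (hle n)
        _ = _ := by rw [integral_const, smul_eq_mul, mul_comm])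
    have hR : ∫ y, ∑' n : ℕ, z ^ n / (n.factorial : ℂ) * (Real.exp (-(n : ℝ) * y) : ℂ) ∂κ =
        complexMGF (fun y : ℝ => Real.exp (-y)) κ z := by
      rw [complexMGF]
      refine integral_congr_ae (Eventually.of_forall fun y => ?_)
      have hs := NormedSpace.expSeries_div_hasSum_exp (𝔸 := ℂ) (z * (Real.exp (-y) : ℂ))
      rw [← Complex.exp_eq_exp_ℂ] at hs
      refine (tsum_congr fun n => ?_).trans hs.tsum_eq
      rw [mul_pow, ← Complex.ofReal_pow, ← Real.exp_nat_mul, mul_neg, neg_mul]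
      ring
    rw [hR] at hsum
    refine hsum.congr_fun ?_
    intro n
    rw [integral_const_mul, integral_complex_ofReal,
      integral_eq_lintegral_of_nonneg_ae (Eventually.of_forall fun _ => (Real.exp_pos _).le)
        (by fun_prop)]
  have hmap : κ₁.map (fun y : ℝ => Real.exp (-y)) = κ₂.map (fun y : ℝ => Real.exp (-y)) := by
    refine Measure.ext_of_complexMGF_eq hX.aemeasurable hX.aemeasurable (funext fun z => ?_)
    have e1 := key κ₁ h1 z
    simp_rw [h] at e1
    exact e1.unique (key κ₂ h2 z)
  have hemb : MeasurableEmbedding (fun y : ℝ => Real.exp (-y)) :=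
    hX.measurableEmbedding (Real.exp_injective.comp neg_injective)
  exact hemb.map_injective hmap

/-- Measures on `(0, ∞)` are determined by the integrals of `e^{-ay} - e^{-by}`, where finite. -/
theorem measure_eq_of_forall_lintegral_exp_sub_exp {ν₁ ν₂ : Measure ℝ}
    (h1 : ν₁ (Iic 0) = 0) (h2 : ν₂ (Iic 0) = 0)
    (h : ∀ a b : ℝ, 0 < a → a < b →
      ∫⁻ y, ENNReal.ofReal (Real.exp (-a * y) - Real.exp (-b * y)) ∂ν₁ < ⊤ ∧
      ∫⁻ y, ENNReal.ofReal (Real.exp (-a * y) - Real.exp (-b * y)) ∂ν₁ =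
        ∫⁻ y, ENNReal.ofReal (Real.exp (-a * y) - Real.exp (-b * y)) ∂ν₂) : ν₁ = ν₂ := by
  -- The weight `d` makes both measures finite, and `e^{-ny} d(y)` is again a test function, with
  -- parameters `n+1` and `n+2`. Since `d > 0` on `(0, ∞)`, it can be divided out at the end.
  set d : ℝ → ℝ≥0∞ := fun y => ENNReal.ofReal (Real.exp (-1 * y) - Real.exp (-2 * y)) with hd
  have hdm : Measurable d := by fun_prop
  have hfin1 : ∫⁻ y, d y ∂ν₁ < ⊤ := (h 1 2 one_pos one_lt_two).1
  have hfin2 : ∫⁻ y, d y ∂ν₂ < ⊤ := (h 1 2 one_pos one_lt_two).2 ▸ hfin1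
  have : IsFiniteMeasure (ν₁.withDensity d) := isFiniteMeasure_withDensity hfin1.ne
  have : IsFiniteMeasure (ν₂.withDensity d) := isFiniteMeasure_withDensity hfin2.ne
  have hexp : ∀ (ν : Measure ℝ) (n : ℕ),
      ∫⁻ y, ENNReal.ofReal (Real.exp (-(n : ℝ) * y)) ∂(ν.withDensity d) =
      ∫⁻ y, ENNReal.ofReal (Real.exp (-(n + 1 : ℝ) * y) - Real.exp (-(n + 2 : ℝ) * y)) ∂ν := by
    intro ν n
    rw [lintegral_withDensity_eq_lintegral_mul _ hdm (by fun_prop)]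
    refine lintegral_congr fun y => ?_
    rw [Pi.mul_apply, hd, ← ENNReal.ofReal_mul' (Real.exp_pos _).le, sub_mul, ← Real.exp_add,
      ← Real.exp_add]
    ring_nf
  have hκ : ν₁.withDensity d = ν₂.withDensity d := by
    refine measure_eq_of_forall_lintegral_exp_neg_nat_mul
      (withDensity_absolutelyContinuous _ _ h1) (withDensity_absolutelyContinuous _ _ h2)
      fun n => ?_
    rw [hexp, hexp]
    exact (h (n + 1) (n + 2) (by positivity) (by linarith)).2
  have hinv : ∀ ν : Measure ℝ, ν (Iic 0) = 0 → (ν.withDensity d).withDensity (fun y => (d y)⁻¹) = ν := by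
    intro ν hν
    refine withDensity_inv_same hdm ?_ (Eventually.of_forall fun y => ENNReal.ofReal_ne_top)
    have hpos : ∀ᵐ y ∂ν, 0 < y := by
      rw [ae_iff]
      simpa [Iic] using hν
    filter_upwards [hpos] with y hy
    refine (ENNReal.ofReal_pos.2 (sub_pos.2 (Real.exp_lt_exp.2 ?_))).ne'
    linarith
  rw [← hinv ν₁ h1, ← hinv ν₂ h2, hκ]

/-! ### Properties of `ψ` deduced from its scale function -/

namespace BranchingMechanism

variable {b : BranchingMechanism} {W : ℝ → ℝ} {u : ℝ → ℝ → ℝ}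

theorem psi_zero (b : BranchingMechanism) : b.psi 0 = 0 := by simp [psi]

namespace IsScaleFunction

theorem nonneg' (hW : b.IsScaleFunction W) (x : ℝ) : 0 ≤ W x := by
  rcases lt_or_ge x 0 with hx | hx
  · rw [hW.zero_of_neg x hx]
  · exact hW.nonneg x hx

theorem monotone (hW : b.IsScaleFunction W) : Monotone W := by
  intro x y hxy
  rcases lt_or_ge x 0 with hx | hx
  · rw [hW.zero_of_neg x hx]
    exact hW.nonneg' y
  · exact hW.strictMonoOn.monotoneOn hx (hx.trans hxy) hxy

theorem pos (hW : b.IsScaleFunction W) {x : ℝ} (hx : 0 < x) : 0 < W x :=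
  (hW.nonneg 0 le_rfl).trans_lt (hW.strictMonoOn self_mem_Ici hx.le hx)

/-- The bound `W(1) e^{-q} / q ≤ 1 / ψ(q)`. -/
theorem le_one_div_psi (hW : b.IsScaleFunction W) {q : ℝ} (hq : 0 < q) :
    W 1 * (Real.exp (-q) / q) ≤ 1 / b.psi q := by
  rw [← hW.laplace q hq]
  have h1 : ∫ x in Ioi (1 : ℝ), Real.exp (-q * x) = Real.exp (-q) / q := by
    rw [integral_exp_mul_Ioi (by linarith)]
    rw [mul_one, div_neg, neg_div, neg_neg]
  rw [← h1, ← integral_const_mul]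
  refine (setIntegral_mono_on (g := fun x => Real.exp (-q * x) * W x)
    ((integrableOn_exp_mul_Ioi (by linarith) 1).const_mul _)
    ((hW.integrableOn q hq).mono_set (Ioi_subset_Ioi zero_le_one)) measurableSet_Ioi ?_).trans
    (setIntegral_mono_set (hW.integrableOn q hq)
      (Eventually.of_forall fun x => mul_nonneg (Real.exp_pos _).le (hW.nonneg' x))
      (Ioi_subset_Ioi zero_le_one).eventuallyLE)
  intro x hx
  rw [mul_comm]
  exact mul_le_mul_of_nonneg_left (hW.monotone (le_of_lt hx)) (Real.exp_pos _).le

theorem psi_pos (hW : b.IsScaleFunction W) {q : ℝ} (hq : 0 < q) : 0 < b.psi q := by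
  have h := hW.le_one_div_psi hq
  have h1 : 0 < W 1 * (Real.exp (-q) / q) := mul_pos (hW.pos one_pos) (by positivity)
  -- As `1 / 0 = 0`, positivity of the quotient also excludes `ψ(q) = 0`.
  exact one_div_pos.1 (h1.trans_le h)

/-- At most linear growth of `ψ` at `0` is what prevents the cumulant from reaching `0` in finite
time. -/
theorem psi_le (hW : b.IsScaleFunction W) {q : ℝ} (hq : 0 ≤ q) :
    b.psi q ≤ Real.exp q / W 1 * q := by
  rcases hq.eq_or_lt with rfl | hq
  · simp [psi_zero]
  have h := hW.le_one_div_psi hq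
  have h1 := hW.pos one_pos
  rw [le_div_iff₀ (hW.psi_pos hq), Real.exp_neg] at h
  rw [div_mul_eq_mul_div, le_div_iff₀ h1]
  have h2 : 0 < Real.exp q := Real.exp_pos q
  have h3 : W 1 * ((Real.exp q)⁻¹ / q) * b.psi q = b.psi q * W 1 / (Real.exp q * q) := by
    field_simp
  rw [h3, div_le_one (by positivity)] at h
  exact h

theorem psi_nonneg (hW : b.IsScaleFunction W) {q : ℝ} (hq : 0 ≤ q) : 0 ≤ b.psi q := by
  rcases hq.eq_or_lt with rfl | hq
  · rw [psi_zero]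
  · exact (hW.psi_pos hq).le

/-- Dominated convergence in the Laplace transform of `W`, with the transform at `q / 2` as
majorant. -/
theorem continuousAt_psi_inv (hW : b.IsScaleFunction W) {q : ℝ} (hq : 0 < q) :
    ContinuousAt (fun q => (b.psi q)⁻¹) q := by
  have hc : ContinuousAt (fun q => ∫ x in Ioi (0 : ℝ), Real.exp (-q * x) * W x) q := by
    refine continuousAt_of_dominated (bound := fun x => Real.exp (-(q / 2) * x) * W x) ?_ ?_
      (hW.integrableOn (q / 2) (by positivity)) ?_
    · exact Eventually.of_forall fun r =>
        (Measurable.mul (by fun_prop) hW.monotone.measurable).aestronglyMeasurable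
    · filter_upwards [Ioi_mem_nhds (half_lt_self hq)] with r hr
      refine (ae_restrict_iff' measurableSet_Ioi).2 (Eventually.of_forall fun x hx => ?_)
      rw [Real.norm_of_nonneg (mul_nonneg (Real.exp_pos _).le (hW.nonneg' x))]
      refine mul_le_mul_of_nonneg_right (Real.exp_le_exp.2 ?_) (hW.nonneg' x)
      exact mul_le_mul_of_nonneg_right (neg_le_neg (le_of_lt hr)) (le_of_lt hx)
    · exact Eventually.of_forall fun x => by fun_prop
  refine hc.congr ?_
  filter_upwards [Ioi_mem_nhds hq] with r hr
  rw [hW.laplace r hr, one_div]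

end IsScaleFunction

/-- `q ↦ ∫_1^q φ(s) / ψ(s) ds`. -/
noncomputable def primitive (b : BranchingMechanism) (φ : ℝ → ℝ) (q : ℝ) : ℝ :=
  ∫ s in (1 : ℝ)..q, φ s * (b.psi s)⁻¹

variable {φ : ℝ → ℝ}

theorem IsScaleFunction.continuousOn_mul_psi_inv (hW : b.IsScaleFunction W) (hφ : Continuous φ) :
    ContinuousOn (fun s => φ s * (b.psi s)⁻¹) (Ioi 0) :=
  fun _ hs => (hφ.continuousAt.mul (hW.continuousAt_psi_inv hs)).continuousWithinAt

theorem IsScaleFunction.intervalIntegrable (hW : b.IsScaleFunction W) (hφ : Continuous φ)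
    {p q : ℝ} (hp : 0 < p) (hq : 0 < q) :
    IntervalIntegrable (fun s => φ s * (b.psi s)⁻¹) volume p q :=
  ((hW.continuousOn_mul_psi_inv hφ).mono
    fun _ hs => (lt_min hp hq).trans_le hs.1).intervalIntegrable

theorem IsScaleFunction.hasDerivAt_primitive (hW : b.IsScaleFunction W) (hφ : Continuous φ)
    {q : ℝ} (hq : 0 < q) : HasDerivAt (b.primitive φ) (φ q * (b.psi q)⁻¹) q := by
  have hc := hW.continuousOn_mul_psi_inv hφ
  exact intervalIntegral.integral_hasDerivAt_right (hW.intervalIntegrable hφ one_pos hq)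
    (hc.stronglyMeasurableAtFilter isOpen_Ioi q hq) (hc.continuousAt (Ioi_mem_nhds hq))

theorem IsScaleFunction.primitive_sub (hW : b.IsScaleFunction W) (hφ : Continuous φ)
    {p q : ℝ} (hp : 0 < p) (hq : 0 < q) :
    b.primitive φ q - b.primitive φ p = ∫ s in p..q, φ s * (b.psi s)⁻¹ :=
  intervalIntegral.integral_interval_sub_left (hW.intervalIntegrable hφ one_pos hq)
    (hW.intervalIntegrable hφ one_pos hp)

theorem IsScaleFunction.strictMonoOn_primitive_one (hW : b.IsScaleFunction W) :
    StrictMonoOn (b.primitive 1) (Ioi 0) := by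
  intro p hp q hq hpq
  rw [← sub_pos, hW.primitive_sub continuous_one hp hq]
  refine intervalIntegral.intervalIntegral_pos_of_pos_on
    (hW.intervalIntegrable continuous_one hp hq) (fun s hs => ?_) hpq
  simpa using hW.psi_pos (lt_trans hp hs.1)

/-! ### The cumulant flow -/

namespace IsCumulant

variable (hu : b.IsCumulant u) (hW : b.IsScaleFunction W) {q : ℝ} (hq : 0 < q)
include hu hW hq

theorem antitoneOn : AntitoneOn (fun t => u t q) (Ici 0) := by
  refine antitoneOn_of_hasDerivWithinAt_nonpos (convex_Ici 0)
    (fun t ht => ((hu q hq).2 t ht).2.continuousWithinAt) (f' := fun t => -b.psi (u t q))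
    (fun t ht => ((hu q hq).2 t (interior_subset ht)).2.mono interior_subset) fun t ht => ?_
  have := hW.psi_nonneg ((hu q hq).2 t (interior_subset ht)).1
  linarith

theorem le {t : ℝ} (ht : 0 ≤ t) : u t q ≤ q := by
  have := hu.antitoneOn hW hq self_mem_Ici (mem_Ici.2 ht) ht
  simpa [(hu q hq).1] using this

/-- A Grönwall argument: `ψ(s) ≤ C s` on `[0, q]` makes `u_t(q) e^{Ct}` nondecreasing. Positivity
keeps the flow where the primitives of `φ/ψ` are differentiable. -/
theorem pos {t : ℝ} (ht : 0 ≤ t) : 0 < u t q := by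
  set C := Real.exp q / W 1 with hC
  have hmono : MonotoneOn (fun t => u t q * Real.exp (C * t)) (Ici 0) := by
    have hd : ∀ t ∈ Ici (0 : ℝ), HasDerivWithinAt (fun t => u t q * Real.exp (C * t))
        (-b.psi (u t q) * Real.exp (C * t) + u t q * (Real.exp (C * t) * C)) (Ici 0) t := by
      intro t ht
      refine ((hu q hq).2 t ht).2.mul ?_
      exact (((hasDerivAt_id t).const_mul C).exp.congr_deriv (by simp)).hasDerivWithinAt
    refine monotoneOn_of_hasDerivWithinAt_nonneg (convex_Ici 0)
      (fun t ht => (hd t ht).continuousWithinAt)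
      (fun t ht => (hd t (interior_subset ht)).mono interior_subset) fun t ht => ?_
    have ht' : 0 ≤ t := interior_subset ht
    have h0 := ((hu q hq).2 t ht').1
    have h1 : b.psi (u t q) ≤ C * u t q := by
      refine (hW.psi_le h0).trans (mul_le_mul_of_nonneg_right ?_ h0)
      exact div_le_div_of_nonneg_right (Real.exp_le_exp.2 (hu.le hW hq ht')) (hW.nonneg' 1)
    have h2 : 0 ≤ (C * u t q - b.psi (u t q)) * Real.exp (C * t) :=
      mul_nonneg (sub_nonneg.2 h1) (Real.exp_pos _).le
    linarith
  have h := hmono self_mem_Ici (mem_Ici.2 ht) ht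
  simp only [mul_zero, Real.exp_zero, mul_one, (hu q hq).1] at h
  exact pos_of_mul_pos_left (hq.trans_le h) (Real.exp_pos _).le

theorem hasDerivWithinAt_primitive (hφ : Continuous φ) {t : ℝ} (ht : 0 ≤ t) :
    HasDerivWithinAt (fun s => b.primitive φ (u s q)) (-φ (u t q)) (Ici 0) t := by
  have hp := hu.pos hW hq ht
  refine ((hW.hasDerivAt_primitive hφ hp).comp_hasDerivWithinAt t
    ((hu q hq).2 t ht).2).congr_deriv ?_
  have := (hW.psi_pos hp).ne'
  field_simp

/-- Separation of variables: in the coordinate `∫ ds/ψ(s)` the flow is translation at unit speed.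
Decay to `0`, strict order and invariance of `ds/ψ(s)` all follow from this. -/
theorem primitive_one {t : ℝ} (ht : 0 ≤ t) : b.primitive 1 (u t q) = b.primitive 1 q - t := by
  have hd : ∀ s, 0 ≤ s → HasDerivWithinAt (fun s => b.primitive 1 (u s q) + s) 0 (Ici 0) s := by
    intro s hs
    exact ((hu.hasDerivWithinAt_primitive hW hq continuous_one hs).add
      (hasDerivWithinAt_id s _)).congr_deriv (by simp)
  have := constant_of_has_deriv_right_zero
    (fun s hs => (hd s hs.1).continuousWithinAt.mono Icc_subset_Ici_self)
    (fun s hs => (hd s hs.1).mono (Ici_subset_Ici.2 hs.1)) t ⟨ht, le_rfl⟩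
  simp only [(hu q hq).1, add_zero] at this
  linarith

theorem tendsto_zero : Tendsto (fun t => u t q) atTop (𝓝 0) := by
  refine tendsto_order.2 ⟨fun c hc => ?_, fun c hc => ?_⟩
  · filter_upwards [eventually_ge_atTop 0] with t ht using hc.trans (hu.pos hW hq ht)
  · filter_upwards [eventually_ge_atTop 0, eventually_gt_atTop (b.primitive 1 q - b.primitive 1 c)]
      with t ht ht'
    have h := hu.primitive_one hW hq ht
    refine (hW.strictMonoOn_primitive_one.lt_iff_lt (hu.pos hW hq ht) hc).1 ?_
    linarith

end IsCumulant

namespace IsCumulant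

variable (hu : b.IsCumulant u) (hW : b.IsScaleFunction W) {p q : ℝ} (hp : 0 < p) (hpq : p < q)
include hu hW hp hpq

theorem lt {t : ℝ} (ht : 0 ≤ t) : u t p < u t q := by
  have h1 := hu.primitive_one hW hp ht
  have h2 := hu.primitive_one hW (hp.trans hpq) ht
  have h3 := hW.strictMonoOn_primitive_one hp (hp.trans hpq) hpq
  refine (hW.strictMonoOn_primitive_one.lt_iff_lt (hu.pos hW hp ht)
    (hu.pos hW (hp.trans hpq) ht)).1 ?_
  linarith

theorem integral_psi_inv {t : ℝ} (ht : 0 ≤ t) :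
    ∫ s in u t p..u t q, (b.psi s)⁻¹ = ∫ s in p..q, (b.psi s)⁻¹ := by
  have hq := hp.trans hpq
  have e1 := hW.primitive_sub continuous_one hp hq
  have e2 := hW.primitive_sub continuous_one (hu.pos hW hp ht) (hu.pos hW hq ht)
  rw [hu.primitive_one hW hp ht, hu.primitive_one hW hq ht] at e2
  simp only [Pi.one_apply, one_mul] at e1 e2
  rw [← e1, ← e2]
  ring

/-- `∫_0^∞ (e^{-x u_t(p)} - e^{-x u_t(q)}) dt = ∫_p^q (1 - e^{-xs}) / ψ(s) ds`. -/
theorem lintegral_exp_sub_exp {x : ℝ} (hx : 0 ≤ x) :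
    ∫⁻ t in Ioi (0 : ℝ), ENNReal.ofReal (Real.exp (-x * u t p) - Real.exp (-x * u t q)) =
      ENNReal.ofReal (∫ s in p..q, (1 - Real.exp (-x * s)) * (b.psi s)⁻¹) := by
  have hq := hp.trans hpq
  set φ : ℝ → ℝ := fun s => 1 - Real.exp (-x * s) with hφ
  have hφc : Continuous φ := by fun_prop
  have hφ0 : ∀ s, 0 ≤ s → 0 ≤ φ s := fun s hs => by
    have : 0 ≤ x * s := mul_nonneg hx hs
    simpa [hφ] using this
  have hφle : ∀ s, φ s ≤ x * s := fun s => by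
    have := Real.add_one_le_exp (-x * s)
    simp only [hφ]
    linarith
  set m : ℝ → ℝ := fun t => b.primitive φ (u t p) - b.primitive φ (u t q) with hm
  have hd : ∀ t, 0 ≤ t → HasDerivWithinAt m
      (Real.exp (-x * u t p) - Real.exp (-x * u t q)) (Ici 0) t := by
    intro t ht
    refine ((hu.hasDerivWithinAt_primitive hW hp hφc ht).sub
      (hu.hasDerivWithinAt_primitive hW hq hφc ht)).congr_deriv ?_
    simp only [hφ]
    ring
  have hpos : ∀ t ∈ Ioi (0 : ℝ), 0 ≤ Real.exp (-x * u t p) - Real.exp (-x * u t q) := by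
    intro t ht
    refine sub_nonneg.2 (Real.exp_le_exp.2 ?_)
    have := mul_le_mul_of_nonneg_left (hu.lt hW hp hpq (le_of_lt ht)).le hx
    linarith
  have hneg : ∀ t, 0 ≤ t → -m t = ∫ s in u t p..u t q, φ s * (b.psi s)⁻¹ := by
    intro t ht
    rw [← hW.primitive_sub hφc (hu.pos hW hp ht) (hu.pos hW hq ht)]
    simp only [hm]
    ring
  -- Between `u_t(p)` and `u_t(q)` one has `φ(s) ≤ x s ≤ x u_t(q)`, which tends to `0`, while the
  -- integral of `1/ψ` over that interval does not depend on `t`.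
  have hlim : Tendsto m atTop (𝓝 0) := by
    have hb : Tendsto (fun t => x * u t q * ∫ s in p..q, (b.psi s)⁻¹) atTop (𝓝 0) := by
      simpa using ((hu.tendsto_zero hW hq).const_mul x).mul_const (∫ s in p..q, (b.psi s)⁻¹)
    have : Tendsto (fun t => -m t) atTop (𝓝 0) := by
      refine tendsto_of_tendsto_of_tendsto_of_le_of_le' tendsto_const_nhds hb ?_ ?_
      · filter_upwards [eventually_ge_atTop 0] with t ht
        rw [hneg t ht]
        refine intervalIntegral.integral_nonneg (hu.lt hW hp hpq ht).le fun s hs => ?_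
        have hs0 : 0 ≤ s := (hu.pos hW hp ht).le.trans hs.1
        exact mul_nonneg (hφ0 s hs0) (inv_nonneg.2 (hW.psi_nonneg hs0))
      · filter_upwards [eventually_ge_atTop 0] with t ht
        rw [hneg t ht, ← hu.integral_psi_inv hW hp hpq ht, ← intervalIntegral.integral_const_mul]
        have h1 := hu.pos hW hp ht
        have h2 := hu.pos hW hq ht
        refine intervalIntegral.integral_mono_on (hu.lt hW hp hpq ht).le
          (hW.intervalIntegrable hφc h1 h2)
          (hW.intervalIntegrable (φ := fun _ => x * u t q) continuous_const h1 h2) fun s hs => ?_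
        refine mul_le_mul_of_nonneg_right ((hφle s).trans (mul_le_mul_of_nonneg_left hs.2 hx)) ?_
        exact inv_nonneg.2 (hW.psi_nonneg (h1.le.trans hs.1))
    simpa using this.neg
  have hcont : ContinuousWithinAt m (Ici 0) 0 := (hd 0 le_rfl).continuousWithinAt
  have hd' : ∀ t ∈ Ioi (0 : ℝ), HasDerivAt m
      (Real.exp (-x * u t p) - Real.exp (-x * u t q)) t :=
    fun t ht => (hd t (le_of_lt ht)).hasDerivAt (Ici_mem_nhds ht)
  rw [← ofReal_integral_eq_lintegral_ofReal
    (integrableOn_Ioi_deriv_of_nonneg hcont hd' hpos hlim)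
    ((ae_restrict_iff' measurableSet_Ioi).2 (Eventually.of_forall hpos)),
    integral_Ioi_of_hasDerivAt_of_nonneg hcont hd' hpos hlim, zero_sub, hneg 0 le_rfl,
    (hu p hp).1, (hu q hq).1]

end IsCumulant

end BranchingMechanism

/-! ### Test integrals of densities `w(y)/y` -/

/-- Tonelli, after absorbing the factor `1/y` by `(e^{-py} - e^{-qy})/y = ∫_p^q e^{-sy} ds`. -/
theorem setLIntegral_exp_sub_exp_mul_ofReal_div {w : ℝ → ℝ} (hwm : Measurable w) {p q : ℝ}
    (hpq : p ≤ q) :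
    ∫⁻ y in Ioi (0 : ℝ), ENNReal.ofReal (w y / y) *
        ENNReal.ofReal (Real.exp (-p * y) - Real.exp (-q * y)) =
      ∫⁻ s in Ioc p q, ∫⁻ y in Ioi (0 : ℝ), ENNReal.ofReal (Real.exp (-s * y) * w y) := by
  rw [lintegral_lintegral_swap (by fun_prop)]
  refine setLIntegral_congr_fun measurableSet_Ioi fun y hy => ?_
  have hy0 : 0 < y := hy
  have hle : 0 ≤ Real.exp (-p * y) - Real.exp (-q * y) :=
    sub_nonneg.2 (Real.exp_le_exp.2 (mul_le_mul_of_nonneg_right (neg_le_neg hpq) hy0.le))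
  have hI : ∫ s in p..q, Real.exp (-s * y) = (Real.exp (-p * y) - Real.exp (-q * y)) / y := by
    have hd : ∀ s ∈ uIcc p q, HasDerivAt (fun s => -Real.exp (-s * y) / y) (Real.exp (-s * y)) s := by
      intro s _
      refine ((((hasDerivAt_neg s).mul_const y).exp.neg).div_const y).congr_deriv ?_
      field_simp
    rw [intervalIntegral.integral_eq_sub_of_hasDerivAt hd
      (Continuous.intervalIntegrable (by fun_prop) _ _)]
    ring
  have hint : IntegrableOn (fun s => Real.exp (-s * y)) (Ioc p q) :=
    (Continuous.intervalIntegrable (by fun_prop) p q).1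
  have h1 : ∫⁻ s in Ioc p q, ENNReal.ofReal (Real.exp (-s * y)) =
      ENNReal.ofReal ((Real.exp (-p * y) - Real.exp (-q * y)) / y) := by
    rw [← hI, intervalIntegral.integral_of_le hpq, ofReal_integral_eq_lintegral_ofReal hint
      (Eventually.of_forall fun _ => (Real.exp_pos _).le)]
  simp_rw [fun s => ENNReal.ofReal_mul (p := Real.exp (-s * y)) (q := w y) (Real.exp_pos _).le]
  rw [lintegral_mul_const _ (by fun_prop), h1, ← ENNReal.ofReal_mul' hle,
    ← ENNReal.ofReal_mul (div_nonneg hle hy0.le)]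
  congr 1
  ring

namespace BranchingMechanism.IsScaleFunction

variable {b : BranchingMechanism} {W : ℝ → ℝ} (hW : b.IsScaleFunction W)
include hW

/-- If `w ≥ 0` has Laplace transform `φ / ψ`, then
`∫ (e^{-py} - e^{-qy}) (w(y) / y) dy = ∫_p^q φ(s) / ψ(s) ds`. -/
theorem lintegral_exp_sub_exp_withDensity {w φ : ℝ → ℝ} (hwm : Measurable w)
    (hw : ∀ y, 0 < y → 0 ≤ w y) (hφ : Continuous φ)
    (hint : ∀ s, 0 < s → IntegrableOn (fun y => Real.exp (-s * y) * w y) (Ioi 0))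
    (hlap : ∀ s, 0 < s → ∫ y in Ioi (0 : ℝ), Real.exp (-s * y) * w y = φ s * (b.psi s)⁻¹)
    {p q : ℝ} (hp : 0 < p) (hpq : p ≤ q) :
    ∫⁻ y, ENNReal.ofReal (Real.exp (-p * y) - Real.exp (-q * y))
        ∂((volume.restrict (Ioi (0 : ℝ))).withDensity (fun y => ENNReal.ofReal (w y / y))) =
      ENNReal.ofReal (∫ s in p..q, φ s * (b.psi s)⁻¹) := by
  have hnn : ∀ s, 0 ≤ᵐ[volume.restrict (Ioi (0 : ℝ))] fun y => Real.exp (-s * y) * w y :=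
    fun s => (ae_restrict_iff' measurableSet_Ioi).2
      (Eventually.of_forall fun y hy => mul_nonneg (Real.exp_pos _).le (hw y hy))
  rw [lintegral_withDensity_eq_lintegral_mul _ (by fun_prop) (by fun_prop)]
  simp only [Pi.mul_apply]
  rw [setLIntegral_exp_sub_exp_mul_ofReal_div hwm hpq, intervalIntegral.integral_of_le hpq,
    ofReal_integral_eq_lintegral_ofReal (hW.intervalIntegrable hφ hp (hp.trans_le hpq)).1]
  · refine setLIntegral_congr_fun measurableSet_Ioc fun s hs => ?_
    have hs0 : 0 < s := hp.trans hs.1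
    rw [← hlap s hs0, ofReal_integral_eq_lintegral_ofReal (hint s hs0) (hnn s)]
  · refine (ae_restrict_iff' measurableSet_Ioc).2 (Eventually.of_forall fun s hs => ?_)
    have hs0 : 0 < s := hp.trans hs.1
    simp only [Pi.zero_apply]
    rw [← hlap s hs0]
    exact integral_nonneg_of_ae (hnn s)

theorem lintegral_exp_sub_exp_scaleMeasure {p q : ℝ} (hp : 0 < p) (hpq : p ≤ q) :
    ∫⁻ y, ENNReal.ofReal (Real.exp (-p * y) - Real.exp (-q * y)) ∂(scaleMeasure W) =
      ENNReal.ofReal (∫ s in p..q, (b.psi s)⁻¹) := by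
  have := hW.lintegral_exp_sub_exp_withDensity (φ := fun _ => 1) hW.monotone.measurable
    (fun y _ => hW.nonneg' y) continuous_const hW.integrableOn
    (fun s hs => by rw [hW.laplace s hs, one_mul, one_div]) hp hpq
  simp only [one_mul] at this
  exact this

theorem integrableOn_comp_sub {x : ℝ} (hx : 0 ≤ x) {s : ℝ} (hs : 0 < s) :
    IntegrableOn (fun y => Real.exp (-s * y) * W (y - x)) (Ioi 0) := by
  refine Integrable.mono' (hW.integrableOn s hs)
    ((Measurable.mul (by fun_prop)
      (hW.monotone.measurable.comp (measurable_id.sub_const x))).aestronglyMeasurable)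
    (Eventually.of_forall fun y => ?_)
  rw [Real.norm_of_nonneg (mul_nonneg (Real.exp_pos _).le (hW.nonneg' _))]
  exact mul_le_mul_of_nonneg_left (hW.monotone (sub_le_self y hx)) (Real.exp_pos _).le

theorem laplace_comp_sub {x : ℝ} (hx : 0 ≤ x) {s : ℝ} (hs : 0 < s) :
    ∫ y in Ioi (0 : ℝ), Real.exp (-s * y) * W (y - x) = Real.exp (-x * s) * (b.psi s)⁻¹ := by
  -- The closed half-line is used because `W` is known to vanish only on `(-∞, 0)`. Passing to the
  -- whole line lets translation by `x` act without a boundary term.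
  have h1 : ∫ y in Ici (0 : ℝ), Real.exp (-s * y) * W y = ∫ y, Real.exp (-s * y) * W y :=
    setIntegral_eq_integral_of_forall_compl_eq_zero fun y hy => by
      rw [hW.zero_of_neg y (not_le.1 hy), mul_zero]
  have h2 : ∫ y in Ici (0 : ℝ), Real.exp (-s * y) * W (y - x) =
      ∫ y, Real.exp (-s * y) * W (y - x) :=
    setIntegral_eq_integral_of_forall_compl_eq_zero fun y hy => by
      rw [hW.zero_of_neg _ ((sub_le_self y hx).trans_lt (not_le.1 hy)), mul_zero]
  rw [← integral_Ici_eq_integral_Ioi, h2, ← one_div, ← hW.laplace s hs,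
    ← integral_Ici_eq_integral_Ioi, h1, ← integral_const_mul,
    ← integral_sub_right_eq_self (fun y => Real.exp (-x * s) * (Real.exp (-s * y) * W y)) x]
  refine integral_congr_ae (Eventually.of_forall fun y => ?_)
  simp only
  rw [← mul_assoc, ← Real.exp_add]
  ring_nf

theorem lintegral_exp_sub_exp_potentialDensity {x : ℝ} (hx : 0 ≤ x) {p q : ℝ} (hp : 0 < p)
    (hpq : p ≤ q) :
    ∫⁻ y, ENNReal.ofReal (Real.exp (-p * y) - Real.exp (-q * y))
        ∂((volume.restrict (Ioi (0 : ℝ))).withDensity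
          (fun y => ENNReal.ofReal ((W y - W (y - x)) / y))) =
      ENNReal.ofReal (∫ s in p..q, (1 - Real.exp (-x * s)) * (b.psi s)⁻¹) := by
  refine hW.lintegral_exp_sub_exp_withDensity (w := fun y => W y - W (y - x))
    (hW.monotone.measurable.sub (hW.monotone.measurable.comp (measurable_id.sub_const x)))
    (fun y _ => sub_nonneg.2 (hW.monotone (sub_le_self y hx))) (by fun_prop)
    (fun s hs => ?_) (fun s hs => ?_) hp hpq
  · exact ((hW.integrableOn s hs).sub (hW.integrableOn_comp_sub hx hs)).congr
      (Eventually.of_forall fun y => (mul_sub _ _ _).symm)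
  · refine (integral_congr_ae (Eventually.of_forall fun y => mul_sub _ _ _)).trans ?_
    rw [integral_sub (hW.integrableOn s hs) (hW.integrableOn_comp_sub hx hs), hW.laplace s hs,
      hW.laplace_comp_sub hx hs]
    ring

theorem isLocallyFiniteOnPos_scaleMeasure : IsLocallyFiniteOnPos (scaleMeasure W) := by
  intro K hK hK0
  rw [scaleMeasure, withDensity_apply _ hK.measurableSet,
    Measure.restrict_restrict_of_subset hK0]
  refine Integrable.lintegral_lt_top (ContinuousOn.integrableOn_compact hK ?_)
  exact (hW.continuousOn.mono (hK0.trans Ioi_subset_Ici_self)).div continuousOn_id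
    fun y hy => (hK0 hy).ne'

theorem potentialDensity_le_scaleMeasure (x : ℝ) :
    (volume.restrict (Ioi (0 : ℝ))).withDensity
      (fun y => ENNReal.ofReal ((W y - W (y - x)) / y)) ≤ scaleMeasure W := by
  refine withDensity_mono ((ae_restrict_iff' measurableSet_Ioi).2 (Eventually.of_forall ?_))
  intro y hy
  exact ENNReal.ofReal_le_ofReal
    (div_le_div_of_nonneg_right (sub_le_self _ (hW.nonneg' _)) (le_of_lt hy))

end BranchingMechanism.IsScaleFunction

/-! ### Laws of the process and their mixtures -/

namespace IsCBProcess

variable {b : BranchingMechanism} {Ω : Type*} [MeasurableSpace Ω] {P : Kernel ℝ≥0 Ω}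
  {Z : ℝ≥0 → Ω → ℝ≥0} (hZ : IsCBProcess b P Z)
include hZ

theorem measurable_coe (t : ℝ≥0) : Measurable (fun ω => (Z t ω : ℝ)) :=
  (hZ.measurable t).coe_nnreal_real

theorem measurable_law_time (x : ℝ≥0) :
    Measurable (fun t : ℝ => (P x).map (fun ω => (Z t.toNNReal ω : ℝ))) := by
  have := hZ.isMarkovKernel
  have hm : Measurable (fun p : ℝ × Ω => (Z p.1.toNNReal p.2 : ℝ)) :=
    (hZ.measurable_uncurry.comp
      ((measurable_real_toNNReal.comp measurable_fst).prodMk measurable_snd)).coe_nnreal_real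
  refine Measure.measurable_of_measurable_coe _ fun s hs => ?_
  simp_rw [fun t : ℝ => Measure.map_apply (μ := P x) (hZ.measurable_coe t.toNNReal) hs]
  exact measurable_measure_prodMk_left (ν := P x) (hm hs)

theorem measurable_law_start (t : ℝ≥0) :
    Measurable (fun x : ℝ => (P x.toNNReal).map (fun ω => (Z t ω : ℝ))) :=
  (Measure.measurable_map _ (hZ.measurable_coe t)).comp
    (P.measurable.comp measurable_real_toNNReal)

theorem lintegral_law {u : ℝ → ℝ → ℝ} {x t : ℝ≥0}
    (h : ∀ q : ℝ, 0 < q →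
      ∫ ω, Real.exp (-q * (Z t ω : ℝ)) ∂(P x) = Real.exp (-(x : ℝ) * u t q))
    {p q : ℝ} (hp : 0 < p) (hpq : p < q) :
    ∫⁻ y, ENNReal.ofReal (Real.exp (-p * y) - Real.exp (-q * y))
        ∂((P x).map (fun ω => (Z t ω : ℝ))) =
      ENNReal.ofReal (Real.exp (-(x : ℝ) * u t p) - Real.exp (-(x : ℝ) * u t q)) := by
  have := hZ.isMarkovKernel
  have hm := hZ.measurable_coe t
  have hint : ∀ r : ℝ, 0 < r → Integrable (fun ω => Real.exp (-r * (Z t ω : ℝ))) (P x) := by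
    intro r hr
    refine Integrable.of_bound (C := 1)
      (Real.measurable_exp.comp (hm.const_mul (-r))).aestronglyMeasurable
      (Eventually.of_forall fun ω => ?_)
    rw [Real.norm_of_nonneg (Real.exp_pos _).le, Real.exp_le_one_iff]
    exact mul_nonpos_of_nonpos_of_nonneg (neg_nonpos.2 hr.le) (Z t ω).coe_nonneg
  rw [lintegral_map (by fun_prop) hm, ← h p hp, ← h q (hp.trans hpq),
    ← integral_sub (hint p hp) (hint q (hp.trans hpq))]
  refine (ofReal_integral_eq_lintegral_ofReal ((hint p hp).sub (hint q (hp.trans hpq))) ?_).symm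
  refine Eventually.of_forall fun ω => sub_nonneg.2 (Real.exp_le_exp.2 ?_)
  exact mul_le_mul_of_nonneg_right (neg_le_neg hpq.le) (Z t ω).coe_nonneg

end IsCBProcess

theorem lintegral_exp_sub_exp_restrict_bind {m : Measure ℝ} {κ : ℝ → Measure ℝ}
    (hκ : Measurable κ) {p q : ℝ} (hpq : p ≤ q) :
    ∫⁻ y, ENNReal.ofReal (Real.exp (-p * y) - Real.exp (-q * y))
        ∂((m.bind κ).restrict (Ioi 0)) =
      ∫⁻ x, ∫⁻ y, ENNReal.ofReal (Real.exp (-p * y) - Real.exp (-q * y)) ∂(κ x) ∂m := by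
  rw [← Measure.lintegral_bind hκ.aemeasurable (by fun_prop)]
  -- The test function is nonpositive on `(-∞, 0]`, so `ENNReal.ofReal` kills it there; the
  -- restriction to `(0, ∞)` thus loses nothing.
  refine setLIntegral_eq_of_support_subset fun y hy => ?_
  by_contra hy0
  refine hy (ENNReal.ofReal_of_nonpos (sub_nonpos.2 (Real.exp_le_exp.2 ?_)))
  have := mul_le_mul_of_nonpos_right hpq (not_lt.1 hy0)
  linarith

theorem restrict_Ioi_apply_Iic {ν : Measure ℝ} : ν.restrict (Ioi 0) (Iic 0) = 0 := by
  rw [Measure.restrict_apply measurableSet_Iic, Iic_inter_Ioi, Ioc_self, measure_empty]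

theorem withDensity_restrict_Ioi_apply_Iic {ν : Measure ℝ} {f : ℝ → ℝ≥0∞} :
    (ν.restrict (Ioi 0)).withDensity f (Iic 0) = 0 :=
  withDensity_absolutelyContinuous _ _ restrict_Ioi_apply_Iic

/-! ### Potential density, stationarity and vague limit -/

section

variable {b : BranchingMechanism} {Ω : Type*} [MeasurableSpace Ω] {P : Kernel ℝ≥0 Ω}
  {Z : ℝ≥0 → Ω → ℝ≥0} (hZ : IsCBProcess b P Z) {W : ℝ → ℝ} (hW : b.IsScaleFunction W)
include hZ hW

theorem potentialMeasure_eq_withDensity (x : ℝ≥0) :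
    potentialMeasure P Z x = (volume.restrict (Ioi (0 : ℝ))).withDensity
      (fun y => ENNReal.ofReal ((W y - W (y - x)) / y)) := by
  obtain ⟨u, hu, hlap⟩ := hZ.log_laplace
  have key : ∀ p q : ℝ, 0 < p → p < q →
      ∫⁻ y, ENNReal.ofReal (Real.exp (-p * y) - Real.exp (-q * y)) ∂(potentialMeasure P Z x) =
        ENNReal.ofReal (∫ s in p..q, (1 - Real.exp (-(x : ℝ) * s)) * (b.psi s)⁻¹) := by
    intro p q hp hpq
    rw [potentialMeasure, lintegral_exp_sub_exp_restrict_bind (hZ.measurable_law_time x) hpq.le,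
      ← hu.lintegral_exp_sub_exp hW hp hpq x.coe_nonneg]
    refine setLIntegral_congr_fun measurableSet_Ioi fun t ht => ?_
    have := hZ.lintegral_law (u := u) (fun r hr => hlap x t.toNNReal r hr) hp hpq
    rwa [Real.coe_toNNReal t (le_of_lt ht)] at this
  refine measure_eq_of_forall_lintegral_exp_sub_exp restrict_Ioi_apply_Iic
    withDensity_restrict_Ioi_apply_Iic fun p q hp hpq => ?_
  rw [key p q hp hpq, hW.lintegral_exp_sub_exp_potentialDensity x.coe_nonneg hp hpq.le]
  exact ⟨ENNReal.ofReal_lt_top, rfl⟩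

theorem isStationaryMeasure_scaleMeasure : IsStationaryMeasure P Z (scaleMeasure W) := by
  obtain ⟨u, hu, hlap⟩ := hZ.log_laplace
  refine ⟨withDensity_restrict_Ioi_apply_Iic, hW.isLocallyFiniteOnPos_scaleMeasure,
    fun t _ A hA hA0 => ?_⟩
  set κ : ℝ → Measure ℝ := fun x => (P x.toNNReal).map (fun ω => (Z t ω : ℝ)) with hκ
  have hκm : Measurable κ := hZ.measurable_law_start t
  have hpos : ∀ᵐ x ∂(scaleMeasure W), 0 < x := by
    rw [ae_iff]
    have h0 : scaleMeasure W (Iic 0) = 0 := withDensity_restrict_Ioi_apply_Iic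
    simpa [Iic] using h0
  have hres : (scaleMeasure W).restrict (Ioi 0) = scaleMeasure W :=
    Measure.restrict_eq_self_of_ae_mem hpos
  have heq : ((scaleMeasure W).bind κ).restrict (Ioi 0) = scaleMeasure W := by
    refine measure_eq_of_forall_lintegral_exp_sub_exp restrict_Ioi_apply_Iic
      withDensity_restrict_Ioi_apply_Iic fun p q hp hpq => ?_
    have hL : ∫⁻ y, ENNReal.ofReal (Real.exp (-p * y) - Real.exp (-q * y))
        ∂(((scaleMeasure W).bind κ).restrict (Ioi 0)) =
        ENNReal.ofReal (∫ s in p..q, (b.psi s)⁻¹) := by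
      -- The inner integral at `x` is the test function with parameters `u_t(p), u_t(q)` evaluated
      -- at `x`, so the double integral is again a test integral of `μ`.
      rw [lintegral_exp_sub_exp_restrict_bind hκm hpq.le,
        ← hu.integral_psi_inv hW hp hpq t.coe_nonneg,
        ← hW.lintegral_exp_sub_exp_scaleMeasure (hu.pos hW hp t.coe_nonneg) (hu.lt hW hp hpq t.coe_nonneg).le]
      refine lintegral_congr_ae (hpos.mono fun x hx => ?_)
      have := hZ.lintegral_law (u := u) (fun r hr => hlap x.toNNReal t r hr) hp hpq
      rw [Real.coe_toNNReal x hx.le] at this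
      refine this.trans ?_
      simp only [neg_mul, mul_comm x]
    rw [hL, hW.lintegral_exp_sub_exp_scaleMeasure hp hpq.le]
    exact ⟨ENNReal.ofReal_lt_top, rfl⟩
  conv_rhs => rw [← heq, Measure.restrict_apply hA, inter_eq_self_of_subset_left hA0,
    Measure.bind_apply hA hκm.aemeasurable]
  rw [hres]
  refine lintegral_congr fun x => ?_
  rw [hκ, Measure.map_apply (hZ.measurable_coe t) hA]
  rfl

theorem tendstoVaguely_potentialMeasure :
    TendstoVaguely (fun x : ℝ≥0 => potentialMeasure P Z x) atTop (scaleMeasure W) := by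
  simp only [potentialMeasure_eq_withDensity hZ hW]
  refine ⟨Eventually.of_forall fun x K hK hK0 =>
    (hW.potentialDensity_le_scaleMeasure x K).trans_lt
      (hW.isLocallyFiniteOnPos_scaleMeasure K hK hK0),
    hW.isLocallyFiniteOnPos_scaleMeasure, fun f _ hf _ _ => ?_⟩
  obtain ⟨M, hM⟩ := hf.isCompact.bddAbove
  -- The integrals are eventually equal to the limit: for `x` beyond the upper bound `M` of the
  -- support, `W(y - x) = 0` wherever `f y ≠ 0`.
  refine tendsto_const_nhds.congr' ?_
  filter_upwards [eventually_gt_atTop M.toNNReal] with x hx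
  have hMx : M < x := (Real.le_coe_toNNReal M).trans_lt (NNReal.coe_lt_coe.2 hx)
  have hWm := hW.monotone.measurable
  rw [scaleMeasure, restrict_withDensity measurableSet_Ioi, restrict_withDensity measurableSet_Ioi,
    integral_withDensity_eq_integral_toReal_smul (by fun_prop)
      (Eventually.of_forall fun _ => ENNReal.ofReal_lt_top),
    integral_withDensity_eq_integral_toReal_smul (by fun_prop)
      (Eventually.of_forall fun _ => ENNReal.ofReal_lt_top)]
  refine integral_congr_ae (Eventually.of_forall fun y => ?_)
  by_cases hy : f y = 0
  · simp [hy]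
  · have hyM : y ≤ M := hM (subset_tsupport f hy)
    simp only
    rw [hW.zero_of_neg (y - x) (by linarith), sub_zero]

end

theorem mainTheorem5 (b : BranchingMechanism) (hα : 0 ≤ b.α) (hb : b.GreyCondition)
    {Ω : Type*} [MeasurableSpace Ω] (P : Kernel ℝ≥0 Ω) (Z : ℝ≥0 → Ω → ℝ≥0)
    (hZ : IsCBProcess b P Z) (W : ℝ → ℝ) (hW : b.IsScaleFunction W) :
    (∀ x : ℝ≥0, 0 < x → potentialMeasure P Z x =
      (volume.restrict (Ioi (0 : ℝ))).withDensity
        (fun y => ENNReal.ofReal ((W y - W (y - x)) / y))) ∧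
    IsStationaryMeasure P Z (scaleMeasure W) ∧
    TendstoVaguely (fun x : ℝ≥0 => potentialMeasure P Z x) atTop (scaleMeasure W) :=
  ⟨fun x _ => potentialMeasure_eq_withDensity hZ hW x, isStationaryMeasure_scaleMeasure hZ hW,
    tendstoVaguely_potentialMeasure hZ hW⟩
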